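/- Let $0<\alpha,\beta,\gamma<1$ be constants. The stochastic Kronecker graph $K(n,P)$ is the random simple graph whose vertices are the $2^n$ binary strings of length $n$, in which every pair $\{u,v\}$ of distinct vertices is an edge, independently of all other pairs, with probability $p_{u,v}=\prod_{k=1}^n P_{u_k,v_k}$, where $P_{1,1}=\alpha$, $P_{0,0}=\gamma$ and $P_{0,1}=P_{1,0}=\beta$. Let $Z_d$ be the number of vertices of degree $d$ in $K(n,P)$. An event holds a.a.s. if its probability tends to $1$ as $n\to\infty$. (1) A.a.s. $K(n,P)$ does not have a power-law degree distribution, in the following uniform sense. For all constants $c_0>0$, $T>0$, $0<\varepsilon<1$ and every integer $d_0\ge 1$ there is an integer $D\ge d_0$, not depending on $n$, such that a.a.s. there are no real numbers $c\ge c_0$ and $0<\tau\le T$ with $$\left|Z_d-c\,d^{-\tau}2^n\right|\le \varepsilon\, c\,d^{-\tau}2^n\qquad\text{for all integers } d_0\le d\le D.$$ (2) For every fixed integer $d\ge 0$, as $n\to\infty$, $$\mathbb E(Z_d)=\Theta\left(\left((\alpha+\beta)^d+(\beta+\gamma)^d\right)^n\right)\qquad\text{or}\qquad \mathbb E(Z_d)=o(2^n).$$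 (3) For every fixed integer $d\ge 1$, $\mathbb E(Z_d)=\Theta(2^n)$ if and only if $\alpha+\beta=\beta+\gamma=1$. (4) If $\alpha+\beta=\beta+\gamma=1$, then for every fixed integer $d\ge 0$ we have $\mathbb E(Z_d)=(1+o(1))\,2^n/(e\,d!)$ and a.a.s. $Z_d=(1+o(1))\,2^n/(e\,d!)$, that is, for every $\varepsilon>0$, a.a.s. $\left|Z_d-2^n/(e\,d!)\right|\le\varepsilon\,2^n/(e\,d!)$. -/

import Mathlib

open MeasureTheory ProbabilityTheory Filter Topology Asymptotics unitInterval

namespace Kronecker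

/-- Vertices: binary strings of length `n`. -/
abbrev Vertex (n : ℕ) : Type := Fin n → Fin 2

/-- The symmetric probability matrix `P`, indexed by binary digits: the entry is `α` for the digit
pair `(1, 1)`, `γ` for `(0, 0)` and `β` for `(0, 1)` and `(1, 0)`. -/
def probMatrix (α β γ : I) : Matrix (Fin 2) (Fin 2) I :=
  !![γ, β; β, α]

theorem probMatrix_comm (α β γ : I) (a b : Fin 2) :
    probMatrix α β γ a b = probMatrix α β γ b a := by
  fin_cases a <;> fin_cases b <;> rfl

/-- The edge probability `p_{u,v} = ∏ₖ P (u k) (v k)` of the unordered pair `{u, v}`. -/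
noncomputable def edgeProb (α β γ : I) (n : ℕ) : Sym2 (Vertex n) → I :=
  Sym2.lift ⟨fun u v => ∏ k, probMatrix α β γ (u k) (v k), fun u v =>
    Finset.prod_congr rfl fun k _ => probMatrix_comm α β γ (u k) (v k)⟩

/-- Independent coins, one for every unordered pair `e`, equal to `true` with probability
`edgeProb α β γ n e`. -/
noncomputable def coinMeasure (α β γ : I) (n : ℕ) : Measure (Sym2 (Vertex n) → Bool) :=
  Measure.pi fun e => bernoulliMeasure true false (edgeProb α β γ n e)

/-- The simple graph whose edges are the pairs of distinct vertices whose coin shows `true`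
(`SimpleGraph.fromEdgeSet` discards the diagonal pairs). -/
def coinGraph {n : ℕ} (ω : Sym2 (Vertex n) → Bool) : SimpleGraph (Vertex n) :=
  SimpleGraph.fromEdgeSet {e | ω e = true}

theorem measurable_coinGraph (n : ℕ) :
    Measurable (coinGraph : (Sym2 (Vertex n) → Bool) → SimpleGraph (Vertex n)) :=
  Measurable.of_discrete

/-- The stochastic Kronecker graph `K(n, P)`, as a law on simple graphs with vertex set
`Vertex n`. -/
noncomputable def kroneckerGraph (α β γ : I) (n : ℕ) : Measure (SimpleGraph (Vertex n)) :=
  (coinMeasure α β γ n).map coinGraph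

instance (α β γ : I) (n : ℕ) : IsProbabilityMeasure (coinMeasure α β γ n) := by
  unfold coinMeasure; infer_instance

instance (α β γ : I) (n : ℕ) : IsProbabilityMeasure (kroneckerGraph α β γ n) :=
  Measure.isProbabilityMeasure_map (measurable_coinGraph n).aemeasurable

/-- The number of vertices of degree `d` in a finite graph. -/
noncomputable def numDegree {V : Type} (G : SimpleGraph V) (d : ℕ) : ℕ :=
  {v : V | (G.neighborSet v).ncard = d}.ncard

/-- The expected number of vertices of degree `d` in `K(n, P)`. -/
noncomputable def expNumDegree (α β γ : I) (d n : ℕ) : ℝ :=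
  ∫ G, (numDegree G d : ℝ) ∂(kroneckerGraph α β γ n)

/-- `K(n, P)` has the property `Q` asymptotically almost surely. -/
def AAS (α β γ : I) (Q : ∀ n, SimpleGraph (Vertex n) → Prop) : Prop :=
  Tendsto (fun n => (kroneckerGraph α β γ n).real {G | Q n G}) atTop (𝓝 1)

/-- In the finite graph `G`, for every degree `d` with `d₀ ≤ d ≤ D`, the number of vertices of
degree `d` agrees with `c * d ^ (-τ) * |V|` up to a factor between `1 - ε` and `1 + ε`. -/
def IsPowerLaw {V : Type} (G : SimpleGraph V) (c τ ε : ℝ) (d₀ D : ℕ) : Prop :=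
  ∀ d : ℕ, d₀ ≤ d → d ≤ D →
    |(numDegree G d : ℝ) - c * (d : ℝ) ^ (-τ) * (Nat.card V : ℝ)| ≤
      ε * (c * (d : ℝ) ^ (-τ) * (Nat.card V : ℝ))

end Kronecker

/-! The degree of `u` is a sum of independent indicators whose mean, up to the diagonal pair, is the
product over the digits of `u` of the row sums `α + β` and `β + γ`. Its logarithm is therefore a
walk `∑ k, log (rowSum (u k))`.

A positive degree `d` is unlikely when the mean is close to zero (union bound) or large
(`real_sum_eq_le_exp`), so only strings whose walk ends in a bounded window matter. Unless both row
sums are 1, binomial anticoncentration leaves only `o(2^n)` such strings. For `d = 0` small means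
are harmless, and the product of the row sums decides: if it exceeds 1, a moment of order `-t` of
the mean shows that almost no vertex is isolated; if it is at most 1, one of each string and its
complement has mean at most 1, so isolated vertices have positive density.

When both row sums are 1, every mean is 1 and every edge probability is exponentially small. Le
Cam's inequality makes each degree nearly Poisson(1), and two degrees share a single coin, so
Chebyshev's inequality gives concentration.

A power law fails at one degree: at `d₀` itself in the noncritical case, and otherwise at a large
`D`, where `1 / D!` falls below every admissible power. -/

namespace Kronecker

/-! ### Poisson weights -/

/-- The mass at `d` of the Poisson distribution with parameter `x`. -/
noncomputable def poissonWeight (d : ℕ) (x : ℝ) : ℝ := Real.exp (-x) * (x ^ d / d.factorial)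

/-- The derivative of `poissonWeight d`. -/
noncomputable def poissonWeightDeriv : ℕ → ℝ → ℝ
  | 0, x => -poissonWeight 0 x
  | d + 1, x => poissonWeight d x - poissonWeight (d + 1) x

theorem poissonWeight_nonneg (d : ℕ) {x : ℝ} (hx : 0 ≤ x) : 0 ≤ poissonWeight d x := by
  unfold poissonWeight; positivity

theorem poissonWeight_le_one (d : ℕ) {x : ℝ} (hx : 0 ≤ x) : poissonWeight d x ≤ 1 := by
  unfold poissonWeight
  calc Real.exp (-x) * (x ^ d / d.factorial) ≤ Real.exp (-x) * Real.exp x := by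
        gcongr; exact Real.pow_div_factorial_le_exp x hx d
    _ = 1 := by rw [← Real.exp_add]; simp

theorem hasDerivAt_poissonWeight (d : ℕ) (x : ℝ) :
    HasDerivAt (poissonWeight d) (poissonWeightDeriv d x) x := by
  have h1 : HasDerivAt (fun x : ℝ => Real.exp (-x)) (-Real.exp (-x)) x := by
    simpa using (hasDerivAt_neg x).exp
  have h2 := h1.mul ((hasDerivAt_pow d x).div_const (d.factorial : ℝ))
  refine h2.congr_deriv ?_
  cases d with
  | zero => simp [poissonWeightDeriv, poissonWeight]
  | succ d =>
    simp only [poissonWeightDeriv, poissonWeight, Nat.factorial_succ]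
    push_cast
    have : (d.factorial : ℝ) ≠ 0 := by positivity
    field_simp
    ring

/-- The derivative is minus a probability or a difference of two probabilities. -/
theorem abs_poissonWeightDeriv_le (d : ℕ) {x : ℝ} (hx : 0 ≤ x) :
    |poissonWeightDeriv d x| ≤ 1 := by
  cases d with
  | zero =>
    have := poissonWeight_nonneg 0 hx
    have := poissonWeight_le_one 0 hx
    simp only [poissonWeightDeriv]
    rw [abs_le]; constructor <;> linarith
  | succ d =>
    have := poissonWeight_nonneg d hx
    have := poissonWeight_le_one d hx
    have := poissonWeight_nonneg (d + 1) hx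
    have := poissonWeight_le_one (d + 1) hx
    simp only [poissonWeightDeriv]
    rw [abs_le]; constructor <;> linarith

theorem abs_poissonWeight_sub_le (d : ℕ) {x y : ℝ} (hx : 0 ≤ x) (hy : 0 ≤ y) :
    |poissonWeight d y - poissonWeight d x| ≤ |y - x| := by
  have := Convex.norm_image_sub_le_of_norm_hasDerivWithin_le (𝕜 := ℝ) (s := Set.Ici 0)
    (f := poissonWeight d) (C := 1)
    (fun z _ => (hasDerivAt_poissonWeight d z).hasDerivWithinAt)
    (fun z hz => abs_poissonWeightDeriv_le d hz) (convex_Ici 0) hx hy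
  simpa using this

theorem abs_poissonWeightDeriv_sub_le (d : ℕ) {x y : ℝ} (hx : 0 ≤ x) (hy : 0 ≤ y) :
    |poissonWeightDeriv d y - poissonWeightDeriv d x| ≤ 2 * |y - x| := by
  cases d with
  | zero =>
    have := abs_poissonWeight_sub_le 0 hx hy
    have h0 := abs_nonneg (y - x)
    simp only [poissonWeightDeriv]
    rw [abs_le] at this ⊢; constructor <;> linarith
  | succ d =>
    have h1 := abs_poissonWeight_sub_le d hx hy
    have h2 := abs_poissonWeight_sub_le (d + 1) hx hy
    simp only [poissonWeightDeriv]
    rw [abs_le] at h1 h2 ⊢; constructor <;> linarith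

/-- Mean value inequality after subtracting the linear part; the derivative moves by at most `2 * p`
on the interval. This is the cost of adding one indicator in Le Cam's induction. -/
theorem abs_poissonWeight_taylor_le (d : ℕ) {x p : ℝ} (hx : 0 ≤ x) (hp : 0 ≤ p) :
    |poissonWeight d (x + p) - poissonWeight d x - p * poissonWeightDeriv d x| ≤ 2 * p ^ 2 := by
  have := Convex.norm_image_sub_le_of_norm_hasDerivWithin_le (𝕜 := ℝ) (s := Set.Icc x (x + p))
    (f := fun z => poissonWeight d z - z * poissonWeightDeriv d x) (C := 2 * p)
    (f' := fun z => poissonWeightDeriv d z - 1 * poissonWeightDeriv d x) (x := x) (y := x + p)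
    (fun z _ => ((hasDerivAt_poissonWeight d z).sub
      ((hasDerivAt_id z).mul_const _)).hasDerivWithinAt)
    (fun z hz => by
      rw [one_mul, Real.norm_eq_abs]
      refine (abs_poissonWeightDeriv_sub_le d hx (hx.trans hz.1)).trans ?_
      rw [abs_of_nonneg (by linarith [hz.1])]
      linarith [hz.2])
    (convex_Icc _ _) (by simp [hp]) (by simp [hp])
  simp only [Real.norm_eq_abs, add_sub_cancel_left, abs_of_nonneg hp] at this
  calc _ = |poissonWeight d (x + p) - (x + p) * poissonWeightDeriv d x -
        (poissonWeight d x - x * poissonWeightDeriv d x)| := by congr 1; ring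
    _ ≤ _ := this
    _ = _ := by ring

/-! ### Sums of independent indicators -/

section Bernoulli

variable {Ω ι : Type*} [MeasurableSpace Ω] {μ : Measure Ω} {X : ι → Ω → ℕ} {p : ι → ℝ}

/-- A family of independent indicator variables, the `i`-th one with success probability `p i`. -/
structure IsBernoulliFamily (X : ι → Ω → ℕ) (p : ι → ℝ) (μ : Measure Ω) : Prop where
  measurable : ∀ i, Measurable (X i)
  indep : iIndepFun X μ
  le_one : ∀ i ω, X i ω ≤ 1
  prob : ∀ i, μ.real {ω | X i ω = 1} = p i

namespace IsBernoulliFamily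

theorem isProbabilityMeasure (h : IsBernoulliFamily X p μ) : IsProbabilityMeasure μ :=
  h.indep.isProbabilityMeasure

theorem prob_nonneg (h : IsBernoulliFamily X p μ) (i : ι) : 0 ≤ p i := by
  rw [← h.prob i]; exact measureReal_nonneg

theorem prob_le_one (h : IsBernoulliFamily X p μ) (i : ι) : p i ≤ 1 := by
  have := h.isProbabilityMeasure
  rw [← h.prob i]; exact measureReal_le_one

theorem prob_zero (h : IsBernoulliFamily X p μ) (i : ι) : μ.real {ω | X i ω = 0} = 1 - p i := by
  have := h.isProbabilityMeasure
  rw [← h.prob i, ← probReal_compl_eq_one_sub]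
  · congr 1
    ext ω
    have := h.le_one i ω
    simp only [Set.mem_ofPred_eq, Set.mem_compl_iff]
    omega
  · exact h.measurable i (measurableSet_singleton 1)

theorem measurable_sum (h : IsBernoulliFamily X p μ) (s : Finset ι) :
    Measurable fun ω => ∑ i ∈ s, X i ω :=
  Finset.measurable_fun_sum s fun i _ => h.measurable i

theorem measurableSet_sum_eq (h : IsBernoulliFamily X p μ) (s : Finset ι) (d : ℕ) :
    MeasurableSet {ω | ∑ i ∈ s, X i ω = d} :=
  h.measurable_sum s (measurableSet_singleton d)

/-- An indicator outside `s` is independent of the sum of those over `s`. -/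
theorem real_inter_eq (h : IsBernoulliFamily X p μ) {s : Finset ι} {i : ι} (hi : i ∉ s)
    (d e : ℕ) :
    μ.real ({ω | ∑ j ∈ s, X j ω = d} ∩ {ω | X i ω = e}) =
      μ.real {ω | ∑ j ∈ s, X j ω = d} * μ.real {ω | X i ω = e} := by
  have h1 := h.indep.indepFun_finsetSum_of_notMem h.measurable hi
  have h2 := h1.measure_inter_preimage_eq_mul {d} {e} (measurableSet_singleton _)
    (measurableSet_singleton _)
  have h3 : (∑ j ∈ s, X j) ⁻¹' {d} = {ω | ∑ j ∈ s, X j ω = d} := by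
    ext ω; simp
  rw [h3] at h2
  simp only [Measure.real, ← ENNReal.toReal_mul]
  congr 1

theorem real_sum_insert_zero [DecidableEq ι] (h : IsBernoulliFamily X p μ) {s : Finset ι} {i : ι}
    (hi : i ∉ s) :
    μ.real {ω | ∑ j ∈ insert i s, X j ω = 0} =
      (1 - p i) * μ.real {ω | ∑ j ∈ s, X j ω = 0} := by
  rw [← h.prob_zero i, mul_comm, ← h.real_inter_eq hi]
  congr 1
  ext ω
  simp only [Finset.sum_insert hi, Set.mem_ofPred_eq, Set.mem_inter_iff]
  omega

theorem real_sum_insert_succ [DecidableEq ι] (h : IsBernoulliFamily X p μ) {s : Finset ι} {i : ι}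
    (hi : i ∉ s) (d : ℕ) :
    μ.real {ω | ∑ j ∈ insert i s, X j ω = d + 1} =
      (1 - p i) * μ.real {ω | ∑ j ∈ s, X j ω = d + 1} +
        p i * μ.real {ω | ∑ j ∈ s, X j ω = d} := by
  have := h.isProbabilityMeasure
  rw [← h.prob_zero i, mul_comm, ← h.real_inter_eq hi, ← h.prob i, mul_comm,
    ← h.real_inter_eq hi, ← measureReal_union]
  · congr 1
    ext ω
    have := h.le_one i ω
    simp only [Finset.sum_insert hi, Set.mem_ofPred_eq, Set.mem_inter_iff, Set.mem_union]
    omega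
  · refine Set.disjoint_left.2 ?_
    rintro ω ⟨-, h1⟩ ⟨-, h2⟩
    simp only [Set.mem_ofPred_eq] at h1 h2
    omega
  · exact (h.measurableSet_sum_eq s d).inter (h.measurable i (measurableSet_singleton 1))

theorem real_sum_eq_succ_le (h : IsBernoulliFamily X p μ) (s : Finset ι) (d : ℕ) :
    μ.real {ω | ∑ j ∈ s, X j ω = d + 1} ≤ ∑ i ∈ s, p i := by
  classical
  have := h.isProbabilityMeasure
  induction s using Finset.induction_on with
  | empty => simp
  | insert i s hi ih =>
    rw [h.real_sum_insert_succ hi, Finset.sum_insert hi]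
    have h0 := h.prob_nonneg i
    have h1 := h.prob_le_one i
    have h2 : μ.real {ω | ∑ j ∈ s, X j ω = d} ≤ 1 := measureReal_le_one
    have h3 : 0 ≤ μ.real {ω | ∑ j ∈ s, X j ω = d + 1} := measureReal_nonneg
    nlinarith

/-- The factor `2 ^ d` and the halved rate make the induction close: `(1 - p) * 2 ^ (d + 1) + p * 2
^ d = 2 ^ (d + 1) * (1 - p / 2)`. -/
theorem real_sum_eq_le_exp (h : IsBernoulliFamily X p μ) (s : Finset ι) (d : ℕ) :
    μ.real {ω | ∑ j ∈ s, X j ω = d} ≤ 2 ^ d * Real.exp (-(∑ i ∈ s, p i) / 2) := by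
  classical
  have := h.isProbabilityMeasure
  induction s using Finset.induction_on generalizing d with
  | empty =>
    simp only [Finset.sum_empty, neg_zero, zero_div, Real.exp_zero, mul_one]
    exact measureReal_le_one.trans (one_le_pow₀ (by norm_num))
  | insert i s hi ih =>
    have h0 := h.prob_nonneg i
    have h1 := h.prob_le_one i
    have hexp : Real.exp (-(∑ j ∈ insert i s, p j) / 2) =
        Real.exp (-p i / 2) * Real.exp (-(∑ j ∈ s, p j) / 2) := by
      rw [← Real.exp_add, Finset.sum_insert hi]; ring_nf
    have hge : 1 - p i / 2 ≤ Real.exp (-p i / 2) := by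
      have := Real.add_one_le_exp (-p i / 2); linarith
    have hE := Real.exp_pos (-(∑ j ∈ s, p j) / 2)
    rw [hexp]
    generalize Real.exp (-(∑ j ∈ s, p j) / 2) = E at *
    cases d with
    | zero =>
      rw [h.real_sum_insert_zero hi]
      have := ih 0
      calc (1 - p i) * μ.real {ω | ∑ j ∈ s, X j ω = 0} ≤ (1 - p i) * (2 ^ 0 * E) := by
            gcongr
        _ ≤ (1 - p i / 2) * E := by rw [pow_zero, one_mul]; gcongr; linarith
        _ ≤ 2 ^ 0 * (Real.exp (-p i / 2) * E) := by rw [pow_zero, one_mul]; gcongr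
    | succ d =>
      rw [h.real_sum_insert_succ hi]
      calc (1 - p i) * μ.real {ω | ∑ j ∈ s, X j ω = d + 1} +
            p i * μ.real {ω | ∑ j ∈ s, X j ω = d}
          ≤ (1 - p i) * (2 ^ (d + 1) * E) + p i * (2 ^ d * E) := by
            gcongr
            · exact ih _
            · exact ih _
        _ = 2 ^ (d + 1) * ((1 - p i / 2) * E) := by ring
        _ ≤ 2 ^ (d + 1) * (Real.exp (-p i / 2) * E) := by gcongr

/-- **Le Cam's inequality**, pointwise. -/
theorem abs_real_sum_eq_sub_poissonWeight_le (h : IsBernoulliFamily X p μ) (s : Finset ι)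
    (d : ℕ) :
    |μ.real {ω | ∑ j ∈ s, X j ω = d} - poissonWeight d (∑ i ∈ s, p i)| ≤
      2 * ∑ i ∈ s, p i ^ 2 := by
  classical
  have := h.isProbabilityMeasure
  induction s using Finset.induction_on generalizing d with
  | empty => cases d <;> simp [poissonWeight]
  | insert i s hi ih =>
    have h0 := h.prob_nonneg i
    have h1 := h.prob_le_one i
    have hl : 0 ≤ ∑ j ∈ s, p j := Finset.sum_nonneg fun j _ => h.prob_nonneg j
    have ht := abs_poissonWeight_taylor_le d hl h0
    rw [Finset.sum_insert hi, Finset.sum_insert hi, add_comm (p i)]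
    have hS : 0 ≤ ∑ j ∈ s, p j ^ 2 := Finset.sum_nonneg fun j _ => sq_nonneg _
    generalize ∑ j ∈ s, p j ^ 2 = S at *
    generalize ∑ j ∈ s, p j = x at *
    cases d with
    | zero =>
      rw [h.real_sum_insert_zero hi]
      have h2 := ih 0
      simp only [poissonWeightDeriv] at ht
      rw [abs_le] at *
      constructor <;> nlinarith
    | succ d =>
      rw [h.real_sum_insert_succ hi]
      have h2 := ih (d + 1)
      have h3 := ih d
      -- Averaging the two induction hypotheses with weights `1 - p i` and `p i` keeps the error `2
      -- * S`. The averaged Poisson weights are the first-order expansion at `x`, so `ht` adds only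
      -- `2 * p i ^ 2`.
      simp only [poissonWeightDeriv] at ht
      rw [abs_le] at *
      constructor <;> nlinarith

theorem real_sum_eq_inter_sum_eq (h : IsBernoulliFamily X p μ) {s t : Finset ι}
    (hst : Disjoint s t) (d e : ℕ) :
    μ.real ({ω | ∑ i ∈ s, X i ω = d} ∩ {ω | ∑ i ∈ t, X i ω = e}) =
      μ.real {ω | ∑ i ∈ s, X i ω = d} * μ.real {ω | ∑ i ∈ t, X i ω = e} := by
  have h1 := (h.indep.indepFun_finset s t hst h.measurable).comp
    (φ := fun x : s → ℕ => ∑ i, x i) (ψ := fun x : t → ℕ => ∑ i, x i)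
    (by fun_prop) (by fun_prop)
  have h2 := h1.measure_inter_preimage_eq_mul {d} {e} (measurableSet_singleton _)
    (measurableSet_singleton _)
  have hs : ∀ (u : Finset ι) (k : ℕ), ((fun x : u → ℕ => ∑ i, x i) ∘ fun ω (i : u) => X i ω) ⁻¹' {k} =
      {ω | ∑ i ∈ u, X i ω = k} := by
    intro u k
    ext ω
    have := Finset.sum_coe_sort u (fun i => X i ω)
    simp only [Set.mem_preimage, Function.comp_apply, Set.mem_singleton_iff, Set.mem_ofPred_eq,
      this]
  rw [hs, hs] at h2
  simp only [Measure.real, ← ENNReal.toReal_mul, h2]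

end IsBernoulliFamily

end Bernoulli

end Kronecker

namespace Kronecker

/-! ### Degrees in the Kronecker graph -/

/-- Over a finite vertex set this makes every set of graphs measurable. -/
instance {V : Type*} [Countable V] : MeasurableSingletonClass (SimpleGraph V) where
  measurableSet_singleton G := by
    have h : ({G} : Set (SimpleGraph V)) = ⋂ u, ⋂ v, {H | H.Adj u v ↔ G.Adj u v} := by
      ext H
      simp [SimpleGraph.ext_iff, funext_iff]
    rw [h]
    refine MeasurableSet.iInter fun u => MeasurableSet.iInter fun v => ?_
    have hm : Measurable fun H : SimpleGraph V => H.Adj u v :=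
      SimpleGraph.measurable_iff_adj.1 measurable_id u v
    exact hm (MeasurableSet.of_discrete (s := {q : Prop | q ↔ G.Adj u v}))

section

variable {n : ℕ}

/-- The indicator of the event that the coin of the pair `e` shows `true`. -/
def coin (e : Sym2 (Vertex n)) (ω : Sym2 (Vertex n) → Bool) : ℕ := (ω e).toNat

/-- The pairs formed by `u` and another vertex. -/
def star (u : Vertex n) : Finset (Sym2 (Vertex n)) :=
  (Finset.univ.erase u).image fun v => s(u, v)

theorem isBernoulliFamily_coin (α β γ : I) :
    IsBernoulliFamily (coin (n := n)) (fun e => (edgeProb α β γ n e : ℝ))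
      (coinMeasure α β γ n) where
  measurable _ := Measurable.of_discrete
  indep := iIndepFun_pi (X := fun _ : Sym2 (Vertex n) => Bool.toNat)
    fun _ => Measurable.of_discrete.aemeasurable
  le_one e ω := Bool.toNat_le _
  prob e := by
    have h : {ω : Sym2 (Vertex n) → Bool | coin e ω = 1} = Function.eval e ⁻¹' ({true} : Set Bool) := by
      ext ω; simp [coin]
    have hm := (measurePreserving_eval (fun e : Sym2 (Vertex n) =>
      bernoulliMeasure true false (edgeProb α β γ n e)) e).measureReal_preimage
      (s := ({true} : Set Bool)) (MeasurableSet.of_discrete.nullMeasurableSet)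
    rw [h, coinMeasure, hm, bernoulliMeasure_real_apply_of_mem_of_notMem] <;> simp

theorem sum_star {M : Type*} [AddCommMonoid M] (u : Vertex n) (f : Sym2 (Vertex n) → M) :
    ∑ e ∈ star u, f e = ∑ v ∈ Finset.univ.erase u, f s(u, v) :=
  Finset.sum_image fun v _ w _ h => by
    rcases Sym2.eq_iff.1 h with ⟨-, h⟩ | ⟨h, h'⟩
    · exact h
    · exact h'.trans h

theorem mk_mem_star {u v : Vertex n} (h : u ≠ v) : s(u, v) ∈ star u :=
  Finset.mem_image_of_mem _ (by simp [h.symm])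

theorem eq_mk_of_mem_star {u v : Vertex n} (h : u ≠ v) {e : Sym2 (Vertex n)}
    (hu : e ∈ star u) (hv : e ∈ star v) : e = s(u, v) := by
  simp only [star, Finset.mem_image, Finset.mem_erase] at hu hv
  obtain ⟨w, -, rfl⟩ := hu
  obtain ⟨x, -, hx⟩ := hv
  simp only [Sym2.eq_iff] at hx ⊢
  rcases hx with ⟨h1, -⟩ | ⟨h1, -⟩
  · exact absurd h1.symm h
  · simp [h1]

theorem ncard_neighborSet_coinGraph (ω : Sym2 (Vertex n) → Bool) (u : Vertex n) :
    ((coinGraph ω).neighborSet u).ncard = ∑ e ∈ star u, coin e ω := by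
  have h : (coinGraph ω).neighborSet u =
      ((Finset.univ.erase u).filter fun v => ω s(u, v) = true : Finset (Vertex n)) := by
    ext v
    simp only [coinGraph, SimpleGraph.mem_neighborSet, SimpleGraph.fromEdgeSet_adj,
      Set.mem_ofPred_eq, Finset.coe_filter, Finset.mem_erase, Finset.mem_univ, and_true, ne_comm]
    exact and_comm
  rw [h, Set.ncard_coe_finset, sum_star, Finset.card_filter]
  refine Finset.sum_congr rfl fun v _ => ?_
  unfold coin
  cases ω s(u, v) <;> simp

/-- The event that the vertex `u` has degree `d`. -/
def degreeEvent (u : Vertex n) (d : ℕ) : Set (Sym2 (Vertex n) → Bool) :=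
  {ω | ∑ e ∈ star u, coin e ω = d}

theorem numDegree_coinGraph (ω : Sym2 (Vertex n) → Bool) (d : ℕ) :
    (numDegree (coinGraph ω) d : ℝ) = ∑ u, (degreeEvent u d).indicator 1 ω := by
  classical
  have h : {v : Vertex n | ((coinGraph ω).neighborSet v).ncard = d} =
      (Finset.univ.filter fun v => ω ∈ degreeEvent v d : Finset (Vertex n)) := by
    ext v
    rw [Finset.mem_coe, Finset.mem_filter, Set.mem_ofPred_eq, ncard_neighborSet_coinGraph]
    exact (and_iff_right (Finset.mem_univ v)).symm
  rw [numDegree, h, Set.ncard_coe_finset, Finset.card_filter]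
  push_cast
  refine Finset.sum_congr rfl fun v _ => ?_
  simp [Set.indicator_apply]

theorem expNumDegree_eq (α β γ : I) (d n : ℕ) :
    expNumDegree α β γ d n =
      ∑ u : Vertex n, (coinMeasure α β γ n).real (degreeEvent u d) := by
  rw [expNumDegree, kroneckerGraph, integral_map (measurable_coinGraph n).aemeasurable
    Measurable.of_discrete.aestronglyMeasurable]
  simp_rw [numDegree_coinGraph]
  rw [integral_finsetSum _ fun u _ => Integrable.of_finite]
  refine Finset.sum_congr rfl fun u _ => ?_
  rw [integral_indicator_one MeasurableSet.of_discrete]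

theorem kroneckerGraph_real_apply (α β γ : I) (n : ℕ) (s : Set (SimpleGraph (Vertex n))) :
    (kroneckerGraph α β γ n).real s = (coinMeasure α β γ n).real (coinGraph ⁻¹' s) := by
  rw [kroneckerGraph, map_measureReal_apply (measurable_coinGraph n) MeasurableSet.of_discrete]

/-! ### Mean degrees -/

/-- The row sums of the probability matrix. -/
noncomputable def rowSum (α β γ : I) : Fin 2 → ℝ := ![(β : ℝ) + γ, (α : ℝ) + β]

/-- The sum of the edge probabilities at `u`, including that of the diagonal pair. -/
noncomputable def mean (α β γ : I) (u : Vertex n) : ℝ := ∏ k, rowSum α β γ (u k)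

/-- The largest entry of the probability matrix. -/
noncomputable def maxEntry (α β γ : I) : ℝ := max (max α β) γ

theorem edgeProb_mk (α β γ : I) (u v : Vertex n) :
    (edgeProb α β γ n s(u, v) : ℝ) = ∏ k, (probMatrix α β γ (u k) (v k) : ℝ) := by
  have h : edgeProb α β γ n s(u, v) = ∏ k, probMatrix α β γ (u k) (v k) := rfl
  rw [h]
  exact map_prod unitInterval.submonoid.subtype _ _

theorem probMatrix_le_maxEntry (α β γ : I) (i j : Fin 2) :
    (probMatrix α β γ i j : ℝ) ≤ maxEntry α β γ := by
  fin_cases i <;> fin_cases j <;> simp [probMatrix, maxEntry]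

theorem edgeProb_le (α β γ : I) (e : Sym2 (Vertex n)) :
    (edgeProb α β γ n e : ℝ) ≤ maxEntry α β γ ^ n := by
  induction e using Sym2.ind with
  | _ u v =>
    rw [edgeProb_mk]
    refine (Finset.prod_le_prod (fun k _ => (probMatrix α β γ (u k) (v k)).2.1)
      fun k _ => probMatrix_le_maxEntry α β γ _ _).trans ?_
    simp

theorem sum_probMatrix (α β γ : I) (i : Fin 2) :
    ∑ j, (probMatrix α β γ i j : ℝ) = rowSum α β γ i := by
  fin_cases i <;> simp [probMatrix, rowSum, add_comm]

/-- Keeping the diagonal pair lets the sum over all strings factor digit by digit. -/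
theorem sum_edgeProb (α β γ : I) (u : Vertex n) :
    ∑ v, (edgeProb α β γ n s(u, v) : ℝ) = mean α β γ u := by
  simp_rw [edgeProb_mk, mean, ← sum_probMatrix]
  exact (Fintype.prod_sum fun (k : Fin n) (j : Fin 2) => (probMatrix α β γ (u k) j : ℝ)).symm

theorem sum_star_edgeProb (α β γ : I) (u : Vertex n) :
    ∑ e ∈ star u, (edgeProb α β γ n e : ℝ) = mean α β γ u - edgeProb α β γ n s(u, u) := by
  rw [sum_star, ← sum_edgeProb, ← Finset.add_sum_erase _ _ (Finset.mem_univ u)]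
  ring

theorem sum_star_edgeProb_nonneg (α β γ : I) (u : Vertex n) :
    0 ≤ ∑ e ∈ star u, (edgeProb α β γ n e : ℝ) :=
  Finset.sum_nonneg fun e _ => (edgeProb α β γ n e).2.1

theorem sum_star_edgeProb_le (α β γ : I) (u : Vertex n) :
    ∑ e ∈ star u, (edgeProb α β γ n e : ℝ) ≤ mean α β γ u := by
  rw [sum_star_edgeProb]
  linarith [(edgeProb α β γ n s(u, u)).2.1]

theorem mean_nonneg (α β γ : I) (u : Vertex n) : 0 ≤ mean α β γ u :=
  (sum_star_edgeProb_nonneg α β γ u).trans (sum_star_edgeProb_le α β γ u)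

theorem sum_star_sq_edgeProb_le (α β γ : I) (u : Vertex n) :
    ∑ e ∈ star u, (edgeProb α β γ n e : ℝ) ^ 2 ≤ maxEntry α β γ ^ n * mean α β γ u := by
  calc ∑ e ∈ star u, (edgeProb α β γ n e : ℝ) ^ 2
      ≤ ∑ e ∈ star u, maxEntry α β γ ^ n * (edgeProb α β γ n e : ℝ) :=
        Finset.sum_le_sum fun e _ => by
          rw [sq]
          exact mul_le_mul_of_nonneg_right (edgeProb_le α β γ e) (edgeProb α β γ n e).2.1
    _ = maxEntry α β γ ^ n * ∑ e ∈ star u, (edgeProb α β γ n e : ℝ) := by rw [Finset.mul_sum]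
    _ ≤ _ := by
        gcongr
        · exact pow_nonneg ((probMatrix α β γ 0 0).2.1.trans (probMatrix_le_maxEntry α β γ 0 0)) n
        · exact sum_star_edgeProb_le α β γ u

/-! ### The probability of a given degree -/

theorem degreeEvent_succ_le (α β γ : I) (u : Vertex n) (d : ℕ) :
    (coinMeasure α β γ n).real (degreeEvent u (d + 1)) ≤ mean α β γ u :=
  ((isBernoulliFamily_coin α β γ).real_sum_eq_succ_le (star u) d).trans
    (sum_star_edgeProb_le α β γ u)

theorem degreeEvent_le_exp (α β γ : I) (u : Vertex n) (d : ℕ) :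
    (coinMeasure α β γ n).real (degreeEvent u d) ≤
      2 ^ d * Real.exp ((1 - mean α β γ u) / 2) := by
  refine ((isBernoulliFamily_coin α β γ).real_sum_eq_le_exp (star u) d).trans ?_
  rw [sum_star_edgeProb]
  gcongr
  -- The `1` in the exponent pays for the missing diagonal pair.
  linarith [(edgeProb α β γ n s(u, u)).2.2]

/-- Le Cam's inequality gives the term with `mean`; the `+ 1` comes from moving the Poisson
parameter across the diagonal pair, the weight being 1-Lipschitz. -/
theorem abs_degreeEvent_sub_poissonWeight_le (α β γ : I) (u : Vertex n) (d : ℕ) :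
    |(coinMeasure α β γ n).real (degreeEvent u d) - poissonWeight d (mean α β γ u)| ≤
      maxEntry α β γ ^ n * (2 * mean α β γ u + 1) := by
  have h1 := (isBernoulliFamily_coin α β γ).abs_real_sum_eq_sub_poissonWeight_le (star u) d
  have h2 := abs_poissonWeight_sub_le d (mean_nonneg α β γ u) (sum_star_edgeProb_nonneg α β γ u)
  have h3 : |∑ e ∈ star u, (edgeProb α β γ n e : ℝ) - mean α β γ u| ≤ maxEntry α β γ ^ n := by
    rw [sum_star_edgeProb, sub_sub_cancel_left, abs_neg,
      abs_of_nonneg (edgeProb α β γ n s(u, u)).2.1]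
    exact edgeProb_le α β γ _
  have h4 := sum_star_sq_edgeProb_le α β γ u
  refine (abs_sub_le _ _ _).trans ((add_le_add h1 (h2.trans h3)).trans ?_)
  linarith

/-- The events that two vertices have degree `d` are almost uncorrelated. -/
theorem degreeEvent_inter_le (α β γ : I) {u v : Vertex n} (huv : u ≠ v) (d : ℕ) :
    (coinMeasure α β γ n).real (degreeEvent u d ∩ degreeEvent v d) ≤
      (coinMeasure α β γ n).real (degreeEvent u d) * (coinMeasure α β γ n).real (degreeEvent v d)
        + 3 * maxEntry α β γ ^ n := by
  set μ := coinMeasure α β γ n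
  have hB := isBernoulliFamily_coin (n := n) α β γ
  set e := s(u, v)
  -- Off `C` the shared coin contributes nothing, and the stars without `e` are disjoint, hence
  -- independent. `C` is paid for three times: once to pass to `B u ∩ B v`, and once to return from
  -- each of `B u` and `B v`.
  set C : Set (Sym2 (Vertex n) → Bool) := {ω | coin e ω = 1}
  have hC : μ.real C ≤ maxEntry α β γ ^ n := (hB.prob e).trans_le (edgeProb_le α β γ e)
  have hsum : ∀ w, e ∈ star w → ∀ ω,
      ∑ f ∈ star w, coin f ω = coin e ω + ∑ f ∈ (star w).erase e, coin f ω :=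
    fun w hw ω => (Finset.add_sum_erase _ _ hw).symm
  have hcoin : ∀ ω, ω ∉ C → coin e ω = 0 := fun ω hω => by
    have h1 := hB.le_one e ω
    have h2 : coin e ω ≠ 1 := hω
    omega
  have heu : e ∈ star u := mk_mem_star huv
  have hev : e ∈ star v := by
    have := mk_mem_star huv.symm
    rwa [Sym2.eq_swap] at this
  have hdisj : Disjoint ((star u).erase e) ((star v).erase e) := by
    refine Finset.disjoint_left.2 fun f hf hf' => ?_
    rw [Finset.mem_erase] at hf hf'
    exact hf.1 (eq_mk_of_mem_star huv hf.2 hf'.2)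
  set B : Vertex n → Set (Sym2 (Vertex n) → Bool) := fun w =>
    {ω | ∑ f ∈ (star w).erase e, coin f ω = d}
  have h1 : μ.real (degreeEvent u d ∩ degreeEvent v d) ≤ μ.real (B u ∩ B v) + μ.real C := by
    refine (measureReal_mono ?_).trans (measureReal_union_le _ _)
    rintro ω ⟨hu, hv⟩
    by_cases hω : ω ∈ C
    · exact Or.inr hω
    · have h0 := hcoin ω hω
      have h1 := hsum u heu ω
      have h2 := hsum v hev ω
      simp only [degreeEvent, Set.mem_ofPred_eq] at hu hv
      refine Or.inl ⟨?_, ?_⟩ <;> simp only [B, Set.mem_ofPred_eq] <;> omega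
  have h2 : ∀ w, e ∈ star w → μ.real (B w) ≤ μ.real (degreeEvent w d) + μ.real C := by
    intro w hw
    refine (measureReal_mono ?_).trans (measureReal_union_le _ _)
    intro ω hB
    by_cases hω : ω ∈ C
    · exact Or.inr hω
    · have h0 := hcoin ω hω
      have h1 := hsum w hw ω
      simp only [B, Set.mem_ofPred_eq] at hB
      refine Or.inl ?_
      simp only [degreeEvent, Set.mem_ofPred_eq]
      omega
  rw [hB.real_sum_eq_inter_sum_eq hdisj d d] at h1
  have hu := h2 u heu
  have hv := h2 v hev
  have hu1 : μ.real (degreeEvent u d) ≤ 1 := measureReal_le_one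
  have hv1 : μ.real (B v) ≤ 1 := measureReal_le_one
  have hv0 : 0 ≤ μ.real (B v) := measureReal_nonneg
  have hu0 : 0 ≤ μ.real (degreeEvent u d) := measureReal_nonneg
  have hC0 : 0 ≤ μ.real C := measureReal_nonneg
  nlinarith

end

end Kronecker

namespace Kronecker

/-! ### Anticoncentration of sums over binary strings -/

/-- The factor `2 * k + 1` survives the induction since `(2k + 3)(2k + 1) ≤ 4(k + 1)²`. -/
theorem two_mul_add_one_mul_centralBinom_sq_le (k : ℕ) :
    (2 * k + 1) * k.centralBinom ^ 2 ≤ 16 ^ k := by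
  induction k with
  | zero => simp
  | succ k ih =>
    have h := Nat.succ_mul_centralBinom_succ k
    have h2 : (k + 1) ^ 2 * ((2 * (k + 1) + 1) * (k + 1).centralBinom ^ 2) ≤
        (k + 1) ^ 2 * 16 ^ (k + 1) := by
      calc (k + 1) ^ 2 * ((2 * (k + 1) + 1) * (k + 1).centralBinom ^ 2)
          = (2 * (k + 1) + 1) * ((k + 1) * (k + 1).centralBinom) ^ 2 := by ring
        _ = (2 * (k + 1) + 1) * (2 * k + 1) * 4 * ((2 * k + 1) * k.centralBinom ^ 2) := by
            rw [h]; ring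
        _ ≤ (4 * (k + 1) ^ 2) * 4 * 16 ^ k := by
            have h3 : (2 * (k + 1) + 1) * (2 * k + 1) ≤ 4 * (k + 1) ^ 2 := by nlinarith
            gcongr
        _ = (k + 1) ^ 2 * 16 ^ (k + 1) := by ring
    exact Nat.le_of_mul_le_mul_left h2 (by positivity)

theorem mul_choose_sq_le (n r : ℕ) : n * n.choose r ^ 2 ≤ 4 ^ n := by
  obtain ⟨k, rfl | rfl⟩ := Nat.even_or_odd' n
  · calc 2 * k * (2 * k).choose r ^ 2 ≤ (2 * k + 1) * k.centralBinom ^ 2 := by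
          gcongr
          · omega
          · exact Nat.choose_le_centralBinom r k
      _ ≤ 16 ^ k := two_mul_add_one_mul_centralBinom_sq_le k
      _ = 4 ^ (2 * k) := by rw [pow_mul]; norm_num
  · have h : (2 * k + 1).choose r ≤ 2 * k.centralBinom := by
      cases r with
      | zero => simpa [Nat.one_le_iff_ne_zero] using Nat.centralBinom_ne_zero k
      | succ r =>
        rw [Nat.choose_succ_succ']
        linarith [Nat.choose_le_centralBinom r k, Nat.choose_le_centralBinom (r + 1) k]
    calc (2 * k + 1) * (2 * k + 1).choose r ^ 2 ≤ (2 * k + 1) * (2 * k.centralBinom) ^ 2 := by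
          gcongr
      _ = 4 * ((2 * k + 1) * k.centralBinom ^ 2) := by ring
      _ ≤ 4 * 16 ^ k := by gcongr; exact two_mul_add_one_mul_centralBinom_sq_le k
      _ = 4 ^ (2 * k + 1) := by rw [pow_succ, pow_mul]; norm_num; ring

theorem choose_le_two_pow_div_sqrt {n : ℕ} (hn : 0 < n) (r : ℕ) :
    (n.choose r : ℝ) ≤ 2 ^ n / √n := by
  have hn' : (0 : ℝ) < n := by exact_mod_cast hn
  rw [le_div_iff₀ (Real.sqrt_pos.2 hn')]
  refine le_of_sq_le_sq ?_ (by positivity)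
  rw [mul_pow, Real.sq_sqrt hn'.le, ← pow_mul, mul_comm n 2, pow_mul, mul_comm]
  norm_num
  exact_mod_cast mul_choose_sq_le n r

/-- The number of ones in a binary string. -/
def weight {n : ℕ} (u : Vertex n) : ℕ := (Finset.univ.filter fun k => u k = 1).card

theorem card_weight_eq_le (n w : ℕ) :
    (Finset.univ.filter fun u : Vertex n => weight u = w).card ≤ n.choose w := by
  have h : (Finset.powersetCard w (Finset.univ : Finset (Fin n))).card = n.choose w := by simp
  rw [← h]
  refine Finset.card_le_card_of_injOn (fun u => Finset.univ.filter fun k => u k = 1) ?_ ?_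
  · intro u hu
    exact Finset.mem_coe.2 (Finset.mem_powersetCard.2
      ⟨Finset.subset_univ _, (Finset.mem_filter.1 (Finset.mem_coe.1 hu)).2⟩)
  · intro u _ v _ huv
    funext k
    have := congrArg (k ∈ ·) huv
    simp only [Finset.mem_filter, Finset.mem_univ, true_and, eq_iff_iff] at this
    omega

theorem sum_eq_weight {n : ℕ} (z : Fin 2 → ℝ) (u : Vertex n) :
    ∑ k, z (u k) = n * z 0 + weight u * (z 1 - z 0) := by
  have h : ∀ k, z (u k) = z 0 + if u k = 1 then z 1 - z 0 else 0 := by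
    intro k
    rcases Fin.exists_fin_two.1 ⟨u k, rfl⟩ with h | h <;> rw [h] <;> simp
  simp_rw [h, Finset.sum_add_distrib, ← Finset.sum_filter]
  simp [weight, mul_sub]

/-- The sum is affine in the weight with slope `z 1 - z 0`, so the weights lie in a window of length
`2 * L / |z 1 - z 0|` above the smallest one. Each weight is taken by at most `2 ^ n / √n` strings.
-/
theorem card_abs_sum_le {n : ℕ} (hn : 0 < n) {z : Fin 2 → ℝ} (hz : z 0 ≠ z 1) (L : ℝ) :
    ((Finset.univ.filter fun u : Vertex n => |∑ k, z (u k)| ≤ L).card : ℝ) ≤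
      (⌊2 * L / |z 1 - z 0|⌋₊ + 1) * (2 ^ n / √n) := by
  set S := Finset.univ.filter fun u : Vertex n => |∑ k, z (u k)| ≤ L with hS
  set K := ⌊2 * L / |z 1 - z 0|⌋₊
  rcases S.eq_empty_or_nonempty with h0 | h0
  · rw [h0]; simp; positivity
  obtain ⟨v, hv, hmin⟩ := S.exists_min_image weight h0
  have hzpos : 0 < |z 1 - z 0| := abs_pos.2 (sub_ne_zero.2 hz.symm)
  have hsub : S ⊆ (Finset.Icc (weight v) (weight v + K)).biUnion
      fun w => Finset.univ.filter fun u : Vertex n => weight u = w := by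
    intro u hu
    simp only [Finset.mem_biUnion, Finset.mem_Icc, Finset.mem_filter, Finset.mem_univ, true_and]
    refine ⟨weight u, ⟨hmin u hu, ?_⟩, rfl⟩
    have hle := hmin u hu
    simp only [hS, Finset.mem_filter, Finset.mem_univ, true_and, sum_eq_weight] at hu hv
    have h1 : ((weight u - weight v : ℕ) : ℝ) * |z 1 - z 0| ≤ 2 * L := by
      rw [Nat.cast_sub hle, ← abs_of_nonneg (sub_nonneg.2 (Nat.cast_le (α := ℝ).2 hle)),
        ← abs_mul]
      have := abs_sub (n * z 0 + weight u * (z 1 - z 0)) (n * z 0 + weight v * (z 1 - z 0))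
      rw [show (n * z 0 + weight u * (z 1 - z 0)) - (n * z 0 + weight v * (z 1 - z 0)) =
        ((weight u : ℝ) - weight v) * (z 1 - z 0) by ring] at this
      linarith
    have h2 : weight u - weight v ≤ K := Nat.le_floor ((le_div_iff₀ hzpos).2 h1)
    omega
  calc (S.card : ℝ) ≤ ((∑ w ∈ Finset.Icc (weight v) (weight v + K),
        (Finset.univ.filter fun u : Vertex n => weight u = w).card : ℕ) : ℝ) := by
        exact_mod_cast (Finset.card_le_card hsub).trans Finset.card_biUnion_le
    _ ≤ ∑ w ∈ Finset.Icc (weight v) (weight v + K), 2 ^ n / √n := by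
        push_cast
        refine Finset.sum_le_sum fun w _ => ?_
        exact (Nat.cast_le.2 (card_weight_eq_le n w)).trans (choose_le_two_pow_div_sqrt hn w)
    _ = (K + 1) * (2 ^ n / √n) := by
        rw [Finset.sum_const, Nat.card_Icc, nsmul_eq_mul]
        congr 1
        rw [show weight v + K + 1 - weight v = K + 1 by omega]
        push_cast; rfl

/-- If `z 0 = z 1`, the walk is deterministic with nonzero drift and leaves the window for good;
otherwise anticoncentration applies. -/
theorem isLittleO_card_abs_sum_le {z : Fin 2 → ℝ} (hz : z ≠ 0) (L : ℝ) :
    (fun n : ℕ => ((Finset.univ.filter fun u : Vertex n => |∑ k, z (u k)| ≤ L).card : ℝ))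
      =o[atTop] fun n : ℕ => (2 : ℝ) ^ n := by
  by_cases h : z 0 = z 1
  · have h0 : z 0 ≠ 0 := fun h0 => hz (by
      ext i; fin_cases i
      · exact h0
      · exact h.symm.trans h0)
    have ht : Tendsto (fun n : ℕ => (n : ℝ) * |z 0|) atTop atTop :=
      tendsto_natCast_atTop_atTop.atTop_mul_const (abs_pos.2 h0)
    refine (isLittleO_zero _ _).congr' ?_ EventuallyEq.rfl
    filter_upwards [ht.eventually_gt_atTop L] with n hn
    symm
    rw [Nat.cast_eq_zero, Finset.card_eq_zero, Finset.filter_eq_empty_iff]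
    intro u _
    rw [sum_eq_weight, ← h, sub_self, mul_zero, add_zero, abs_mul, Nat.abs_cast]
    exact not_le.2 hn
  · have ht : Tendsto (fun n : ℕ => (⌊2 * L / |z 1 - z 0|⌋₊ + 1) * (√(n : ℝ))⁻¹) atTop (𝓝 0) := by
      rw [← mul_zero ((⌊2 * L / |z 1 - z 0|⌋₊ : ℝ) + 1)]
      exact ((tendsto_inv_atTop_zero.comp Real.tendsto_sqrt_atTop).comp
        tendsto_natCast_atTop_atTop).const_mul _
    rw [isLittleO_iff_tendsto fun n hn => absurd hn (by positivity)]
    refine squeeze_zero' (Eventually.of_forall fun n => by positivity) ?_ ht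
    filter_upwards [eventually_gt_atTop 0] with n hn
    rw [div_le_iff₀ (by positivity)]
    exact (card_abs_sum_le hn h L).trans_eq (by ring)

/-- A sum over binary strings is of smaller order than their number when its terms are small
unless the random walk `∑ k, z (u k)` ends near the origin. -/
theorem isLittleO_sum_of_abs_sum {z : Fin 2 → ℝ} (hz : z ≠ 0) {f : ∀ n, Vertex n → ℝ}
    (hf0 : ∀ n u, 0 ≤ f n u) (hf1 : ∀ n u, f n u ≤ 1)
    (hf : ∀ δ > 0, ∃ L : ℝ, ∀ n u, L < |∑ k, z (u k)| → f n u ≤ δ) :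
    (fun n => ∑ u, f n u) =o[atTop] fun n : ℕ => (2 : ℝ) ^ n := by
  rw [isLittleO_iff]
  intro δ hδ
  obtain ⟨L, hL⟩ := hf (δ / 2) (half_pos hδ)
  filter_upwards [isLittleO_iff.1 (isLittleO_card_abs_sum_le hz L) (half_pos hδ)] with n hn
  rw [Real.norm_of_nonneg (Nat.cast_nonneg _), Real.norm_of_nonneg (by positivity)] at hn
  rw [Real.norm_of_nonneg (Finset.sum_nonneg fun u _ => hf0 n u),
    Real.norm_of_nonneg (by positivity)]
  calc ∑ u, f n u ≤ ∑ u : Vertex n, ((if |∑ k, z (u k)| ≤ L then 1 else 0) + δ / 2) := by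
        refine Finset.sum_le_sum fun u _ => ?_
        split_ifs with h
        · linarith [hf1 n u]
        · linarith [hL n u (not_le.1 h)]
    _ = (Finset.univ.filter fun u : Vertex n => |∑ k, z (u k)| ≤ L).card + δ / 2 * 2 ^ n := by
        rw [Finset.sum_add_distrib, Finset.sum_boole]
        simp [mul_comm]
    _ ≤ δ * 2 ^ n := by linarith

end Kronecker

namespace Kronecker

/-! ### The expected number of vertices of a given degree -/

theorem maxEntry_pos {α β γ : I} (hα : 0 < α) : 0 < maxEntry α β γ :=
  lt_max_of_lt_left (lt_max_of_lt_left hα)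

theorem tendsto_maxEntry_pow {α β γ : I} (hα₀ : 0 < α) (hα : α < 1) (hβ : β < 1) (hγ : γ < 1) :
    Tendsto (fun n : ℕ => maxEntry α β γ ^ n) atTop (𝓝 0) :=
  tendsto_pow_atTop_nhds_zero_of_lt_one (maxEntry_pos hα₀).le (max_lt (max_lt hα hβ) hγ)

theorem rowSum_pos {α β γ : I} (hα : 0 < α) (hγ : 0 < γ) (i : Fin 2) : 0 < rowSum α β γ i := by
  have hα' : (0 : ℝ) < α := hα
  have hγ' : (0 : ℝ) < γ := hγ
  have hβ' := β.2.1
  fin_cases i <;> simp [rowSum] <;> linarith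

theorem mean_eq_exp {α β γ : I} (hα : 0 < α) (hγ : 0 < γ) {n : ℕ} (u : Vertex n) :
    mean α β γ u = Real.exp (∑ k, Real.log (rowSum α β γ (u k))) := by
  rw [Real.exp_sum]
  exact Finset.prod_congr rfl fun k _ => (Real.exp_log (rowSum_pos hα hγ _)).symm

theorem mean_pos {α β γ : I} (hα : 0 < α) (hγ : 0 < γ) {n : ℕ} (u : Vertex n) :
    0 < mean α β γ u :=
  Finset.prod_pos fun _ _ => rowSum_pos hα hγ _

theorem expNumDegree_nonneg (α β γ : I) (d n : ℕ) : 0 ≤ expNumDegree α β γ d n := by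
  rw [expNumDegree_eq]; exact Finset.sum_nonneg fun u _ => measureReal_nonneg

theorem expNumDegree_le_two_pow (α β γ : I) (d n : ℕ) : expNumDegree α β γ d n ≤ 2 ^ n := by
  rw [expNumDegree_eq]
  calc _ ≤ ∑ u : Vertex n, (1 : ℝ) := Finset.sum_le_sum fun u _ => measureReal_le_one
    _ = 2 ^ n := by simp

/-- A walk above `L` means a mean above `exp L`, handled by the exponential bound. A walk below `-L`
means a mean below `exp (-L)`, which bounds the probability only of positive degrees. -/
theorem exists_forall_degreeEvent_succ_le {α β γ : I} (hα : 0 < α) (hγ : 0 < γ) (d : ℕ) {δ : ℝ}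
    (hδ : 0 < δ) :
    ∃ L : ℝ, ∀ n (u : Vertex n), L < |∑ k, Real.log (rowSum α β γ (u k))| →
      (coinMeasure α β γ n).real (degreeEvent u (d + 1)) ≤ δ := by
  have h1 : Tendsto (fun L : ℝ => Real.exp (-L)) atTop (𝓝 0) := Real.tendsto_exp_neg_atTop_nhds_zero
  have h2 : Tendsto (fun L : ℝ => (2 : ℝ) ^ (d + 1) * Real.exp ((1 - Real.exp L) / 2)) atTop
      (𝓝 0) := by
    rw [← mul_zero ((2 : ℝ) ^ (d + 1))]
    refine Tendsto.const_mul _ (Real.tendsto_exp_atBot.comp ?_)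
    refine Tendsto.atBot_div_const (by norm_num) ?_
    exact tendsto_atBot_add_const_left _ _ (tendsto_neg_atTop_atBot.comp Real.tendsto_exp_atTop)
  obtain ⟨L, hL1, hL2⟩ := ((h1.eventually_le_const hδ).and (h2.eventually_le_const hδ)).exists
  refine ⟨L, fun n u hu => ?_⟩
  rcases lt_abs.1 hu with h | h
  · refine (degreeEvent_le_exp α β γ u (d + 1)).trans (le_trans ?_ hL2)
    rw [mean_eq_exp hα hγ]
    gcongr
  · refine (degreeEvent_succ_le α β γ u d).trans (le_trans ?_ hL1)
    rw [mean_eq_exp hα hγ]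
    gcongr
    linarith

theorem isLittleO_expNumDegree_succ {α β γ : I} (hα : 0 < α) (hγ : 0 < γ)
    (h : ¬((α : ℝ) + β = 1 ∧ (β : ℝ) + γ = 1)) (d : ℕ) :
    expNumDegree α β γ (d + 1) =o[atTop] fun n : ℕ => (2 : ℝ) ^ n := by
  have hz : (fun i => Real.log (rowSum α β γ i)) ≠ 0 := by
    intro h0
    refine h ⟨?_, ?_⟩
    · have := Real.exp_log (rowSum_pos (β := β) hα hγ 1)
      rw [congrFun h0 1] at this
      simpa [rowSum] using this.symm
    · have := Real.exp_log (rowSum_pos (β := β) hα hγ 0)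
      rw [congrFun h0 0] at this
      simpa [rowSum] using this.symm
  have := isLittleO_sum_of_abs_sum hz
    (f := fun n u => (coinMeasure α β γ n).real (degreeEvent u (d + 1)))
    (fun n u => measureReal_nonneg) (fun n u => measureReal_le_one)
    (fun δ hδ => exists_forall_degreeEvent_succ_le hα hγ d hδ)
  refine this.congr_left fun n => ?_
  rw [expNumDegree_eq]

/-- Replaces the exponential of a mean by a power, which is multiplicative over the digits. -/
theorem exp_neg_le_rpow_neg {x t : ℝ} (hx : 0 < x) (ht0 : 0 ≤ t) (ht1 : t ≤ 1) :
    Real.exp (-x) ≤ x ^ (-t) := by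
  rcases le_total x 1 with h | h
  · exact (Real.exp_le_one_iff.2 (by linarith)).trans
      (Real.one_le_rpow_of_pos_of_le_one_of_nonpos hx h (by linarith))
  · calc Real.exp (-x) ≤ x ^ (-1 : ℝ) := by
          rw [Real.exp_neg, Real.rpow_neg_one]
          exact inv_anti₀ hx (by linarith [Real.add_one_le_exp x])
      _ ≤ x ^ (-t) := Real.rpow_le_rpow_of_exponent_le h (by linarith)

/-- At `t = 0` the sum equals 2 and has derivative `-log (a * b) < 0`. -/
theorem exists_rpow_neg_add_rpow_neg_lt_two {a b : ℝ} (ha : 0 < a) (hb : 0 < b)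
    (hab : 1 < a * b) : ∃ t : ℝ, 0 < t ∧ t ≤ 1 ∧ a ^ (-t) + b ^ (-t) < 2 := by
  have hderiv : ∀ {c : ℝ}, 0 < c →
      HasDerivAt (fun t : ℝ => c ^ (-t)) (-Real.log c) 0 := by
    intro c hc
    have := (hasDerivAt_neg (0 : ℝ)).const_rpow hc
    simpa using this
  have hd := (hderiv ha).add (hderiv hb)
  have hneg : -Real.log a + -Real.log b < 0 := by
    have := Real.log_pos hab
    rw [Real.log_mul ha.ne' hb.ne'] at this
    linarith
  have hslope := (hasDerivAt_iff_tendsto_slope.1 hd).eventually_lt_const hneg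
  have hslope' : ∀ᶠ t in 𝓝[>] (0 : ℝ),
      slope ((fun t : ℝ => a ^ (-t)) + fun t : ℝ => b ^ (-t)) 0 t < 0 :=
    hslope.filter_mono (nhdsWithin_mono _ fun t ht => ne_of_gt ht)
  have h1 : ∀ᶠ t in 𝓝[>] (0 : ℝ), t ≤ 1 :=
    nhdsWithin_le_nhds (eventually_le_nhds one_pos)
  obtain ⟨t, ht, ht1, ht0⟩ := (hslope'.and (h1.and self_mem_nhdsWithin)).exists
  refine ⟨t, ht0, ht1, ?_⟩
  have ht0' : (0 : ℝ) < t := ht0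
  rw [slope_def_field, sub_zero, div_neg_iff] at ht
  rcases ht with ht | ht
  · linarith [ht.2]
  · have := ht.1
    simp at this
    linarith

theorem isLittleO_expNumDegree_of_one_lt {α β γ : I} (hα : 0 < α) (hγ : 0 < γ)
    (h : 1 < ((α : ℝ) + β) * ((β : ℝ) + γ)) (d : ℕ) :
    expNumDegree α β γ d =o[atTop] fun n : ℕ => (2 : ℝ) ^ n := by
  have ha : 0 < (α : ℝ) + β := by simpa [rowSum] using rowSum_pos (β := β) hα hγ 1
  have hb : 0 < (β : ℝ) + γ := by simpa [rowSum] using rowSum_pos (β := β) hα hγ 0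
  obtain ⟨t, ht0, ht1, ht⟩ := exists_rpow_neg_add_rpow_neg_lt_two ha hb h
  have hle : ∀ n, expNumDegree α β γ d n ≤ 2 ^ d * Real.exp (1 / 2) * 2 ^ t *
      (((α : ℝ) + β) ^ (-t) + ((β : ℝ) + γ) ^ (-t)) ^ n := by
    intro n
    have hsum : ∑ u : Vertex n, mean α β γ u ^ (-t) =
        (((α : ℝ) + β) ^ (-t) + ((β : ℝ) + γ) ^ (-t)) ^ n := by
      have := Fintype.prod_sum fun (_ : Fin n) (j : Fin 2) => rowSum α β γ j ^ (-t)
      rw [Finset.prod_const, Finset.card_univ, Fintype.card_fin, Fin.sum_univ_two] at this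
      rw [add_comm]
      refine Eq.trans ?_ this.symm
      refine Finset.sum_congr rfl fun u _ => ?_
      exact (Real.finsetProd_rpow _ _ (fun k _ => (rowSum_pos hα hγ (u k)).le) _).symm
    rw [expNumDegree_eq, ← hsum, Finset.mul_sum]
    refine Finset.sum_le_sum fun u _ => (degreeEvent_le_exp α β γ u d).trans ?_
    have hm := mean_pos (β := β) hα hγ u
    calc 2 ^ d * Real.exp ((1 - mean α β γ u) / 2)
        = 2 ^ d * Real.exp (1 / 2) * Real.exp (-(mean α β γ u / 2)) := by
          rw [mul_assoc, ← Real.exp_add]; ring_nf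
      _ ≤ 2 ^ d * Real.exp (1 / 2) * (mean α β γ u / 2) ^ (-t) := by
          gcongr
          exact exp_neg_le_rpow_neg (by positivity) ht0.le ht1
      _ = 2 ^ d * Real.exp (1 / 2) * 2 ^ t * mean α β γ u ^ (-t) := by
          rw [Real.div_rpow hm.le (by norm_num), Real.rpow_neg (by norm_num : (0 : ℝ) ≤ 2),
            div_inv_eq_mul]
          ring
  have hO : expNumDegree α β γ d =O[atTop]
      fun n : ℕ => (((α : ℝ) + β) ^ (-t) + ((β : ℝ) + γ) ^ (-t)) ^ n :=
    IsBigO.of_bound _ (Eventually.of_forall fun n => by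
      rw [Real.norm_of_nonneg (expNumDegree_nonneg α β γ d n), Real.norm_of_nonneg (by positivity)]
      exact hle n)
  exact hO.trans_isLittleO (isLittleO_pow_pow_of_lt_left (by positivity) ht)

theorem mean_mul_mean_compl (α β γ : I) {n : ℕ} (u : Vertex n) :
    mean α β γ u * mean α β γ (fun k => u k + 1) =
      (((α : ℝ) + β) * ((β : ℝ) + γ)) ^ n := by
  rw [mean, mean, ← Finset.prod_mul_distrib]
  refine (Finset.prod_eq_pow_card (b := ((α : ℝ) + β) * ((β : ℝ) + γ)) fun k _ => ?_).trans
    (by simp)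
  rcases Fin.exists_fin_two.1 ⟨u k, rfl⟩ with h | h <;> rw [h] <;> simp [rowSum, mul_comm]

/-- The means of a string and its complement multiply to at most 1, so one of the two strings has
mean at most 1 and is isolated with probability bounded below. -/
theorem isTheta_expNumDegree_zero {α β γ : I} (hα₀ : 0 < α) (hα : α < 1) (hβ : β < 1)
    (hγ₀ : 0 < γ) (hγ : γ < 1) (h : ((α : ℝ) + β) * ((β : ℝ) + γ) ≤ 1) :
    expNumDegree α β γ 0 =Θ[atTop] fun n : ℕ => (2 : ℝ) ^ n := by
  refine ⟨IsBigO.of_bound 1 (Eventually.of_forall fun n => ?_), ?_⟩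
  · rw [Real.norm_of_nonneg (expNumDegree_nonneg α β γ 0 n), Real.norm_of_nonneg (by positivity),
      one_mul]
    exact expNumDegree_le_two_pow α β γ 0 n
  -- For a mean at most 1 the Poisson mass at 0 is at least `exp (-1)`, and the error `3 * maxEntry
  -- ^ n` eventually takes at most half of it.
  set c : ℝ := Real.exp (-1) / 2 with hc
  have hc0 : 0 < c := by positivity
  have hm := (tendsto_maxEntry_pow hα₀ hα hβ hγ).eventually_le_const
    (show (0 : ℝ) < c / 3 by positivity)
  refine IsBigO.of_bound (2 / c) ?_
  filter_upwards [hm] with n hn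
  rw [Real.norm_of_nonneg (expNumDegree_nonneg α β γ 0 n), Real.norm_of_nonneg (by positivity)]
  have hlow : ∀ u : Vertex n, mean α β γ u ≤ 1 →
      c ≤ (coinMeasure α β γ n).real (degreeEvent u 0) := by
    intro u hu
    have h1 := (abs_le.1 (abs_degreeEvent_sub_poissonWeight_le α β γ u 0)).1
    have h2 : Real.exp (-1) ≤ poissonWeight 0 (mean α β γ u) := by
      simpa [poissonWeight] using hu
    have h3 : 0 ≤ maxEntry α β γ ^ n := pow_nonneg (maxEntry_pos hα₀).le n
    nlinarith [mean_nonneg α β γ u]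
  -- In `Fin 2`, adding the all-ones string complements every digit.
  let φ : Vertex n ≃ Vertex n := Equiv.addRight 1
  have hsum : ∑ u : Vertex n, (coinMeasure α β γ n).real (degreeEvent (φ u) 0) =
      expNumDegree α β γ 0 n := by
    rw [expNumDegree_eq]
    exact Equiv.sum_comp φ fun u => (coinMeasure α β γ n).real (degreeEvent u 0)
  have htwo : (2 : ℝ) ^ n * c ≤ expNumDegree α β γ 0 n + expNumDegree α β γ 0 n := by
    nth_rw 2 [← hsum]
    rw [expNumDegree_eq, ← Finset.sum_add_distrib]
    calc (2 : ℝ) ^ n * c = ∑ u : Vertex n, c := by simp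
      _ ≤ _ := Finset.sum_le_sum fun u _ => ?_
    have hprod : mean α β γ u * mean α β γ (φ u) ≤ 1 :=
      (mean_mul_mean_compl α β γ u).trans_le (pow_le_one₀ (by
        have := (rowSum_pos (β := β) hα₀ hγ₀ 0).le
        have := (rowSum_pos (β := β) hα₀ hγ₀ 1).le
        simp [rowSum] at *
        positivity) h)
    have hu0 : 0 ≤ (coinMeasure α β γ n).real (degreeEvent u 0) := measureReal_nonneg
    have hv0 : 0 ≤ (coinMeasure α β γ n).real (degreeEvent (φ u) 0) := measureReal_nonneg
    by_cases hu : mean α β γ u ≤ 1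
    · linarith [hlow u hu]
    · have hv : mean α β γ (φ u) ≤ 1 := by
        by_contra hv
        have := one_lt_mul_of_lt_of_le (not_le.1 hu) (not_le.1 hv).le
        linarith
      linarith [hlow _ hv]
  rw [div_mul_eq_mul_div, le_div_iff₀ hc0]
  linarith

end Kronecker

namespace Kronecker

/-! ### The Poisson profile -/

theorem mean_eq_one {α β γ : I} (h1 : (α : ℝ) + β = 1) (h2 : (β : ℝ) + γ = 1) {n : ℕ}
    (u : Vertex n) : mean α β γ u = 1 := by
  refine Finset.prod_eq_one fun k _ => ?_
  rcases Fin.exists_fin_two.1 ⟨u k, rfl⟩ with h | h <;> rw [h] <;> simp [rowSum, h1, h2]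

theorem abs_degreeEvent_sub_le {α β γ : I} (h1 : (α : ℝ) + β = 1) (h2 : (β : ℝ) + γ = 1)
    {n : ℕ} (u : Vertex n) (d : ℕ) :
    |(coinMeasure α β γ n).real (degreeEvent u d) - poissonWeight d 1| ≤
      3 * maxEntry α β γ ^ n := by
  have := abs_degreeEvent_sub_poissonWeight_le α β γ u d
  rw [mean_eq_one h1 h2] at this
  linarith

theorem poissonWeight_one (d : ℕ) : poissonWeight d 1 = 1 / (Real.exp 1 * d.factorial) := by
  rw [poissonWeight, Real.exp_neg, one_pow]
  field_simp

theorem two_pow_div_eq (d n : ℕ) :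
    (2 : ℝ) ^ n / (Real.exp 1 * d.factorial) = 2 ^ n * poissonWeight d 1 := by
  rw [poissonWeight_one, mul_one_div]

theorem poissonWeight_one_pos (d : ℕ) : 0 < poissonWeight d 1 := by
  rw [poissonWeight_one]; positivity

theorem isEquivalent_expNumDegree {α β γ : I} (hα₀ : 0 < α) (hα : α < 1) (hβ : β < 1)
    (hγ : γ < 1) (h1 : (α : ℝ) + β = 1) (h2 : (β : ℝ) + γ = 1) (d : ℕ) :
    expNumDegree α β γ d ~[atTop] fun n : ℕ => (2 : ℝ) ^ n / (Real.exp 1 * (d.factorial : ℝ)) := by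
  simp_rw [two_pow_div_eq]
  have hq := poissonWeight_one_pos d
  have hO : (expNumDegree α β γ d - fun n : ℕ => (2 : ℝ) ^ n * poissonWeight d 1) =O[atTop]
      fun n : ℕ => maxEntry α β γ ^ n * (2 ^ n * poissonWeight d 1) := by
    refine IsBigO.of_bound (3 / poissonWeight d 1) (Eventually.of_forall fun n => ?_)
    have hm : 0 ≤ maxEntry α β γ ^ n := pow_nonneg (maxEntry_pos hα₀).le n
    rw [Real.norm_eq_abs, Real.norm_of_nonneg (by positivity)]
    calc |expNumDegree α β γ d n - 2 ^ n * poissonWeight d 1|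
        = |∑ u : Vertex n,
            ((coinMeasure α β γ n).real (degreeEvent u d) - poissonWeight d 1)| := by
          rw [expNumDegree_eq, Finset.sum_sub_distrib]; simp
      _ ≤ ∑ u : Vertex n, 3 * maxEntry α β γ ^ n :=
          (Finset.abs_sum_le_sum_abs _ _).trans
            (Finset.sum_le_sum fun u _ => abs_degreeEvent_sub_le h1 h2 u d)
      _ = 3 / poissonWeight d 1 * (maxEntry α β γ ^ n * (2 ^ n * poissonWeight d 1)) := by
          simp
          field_simp
  have ho : (fun n : ℕ => maxEntry α β γ ^ n * (2 ^ n * poissonWeight d 1)) =o[atTop]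
      fun n : ℕ => (2 : ℝ) ^ n * poissonWeight d 1 := by
    simpa using ((isLittleO_one_iff ℝ).2 (tendsto_maxEntry_pow hα₀ hα hβ hγ)).mul_isBigO
      (isBigO_refl (fun n : ℕ => (2 : ℝ) ^ n * poissonWeight d 1) atTop)
  exact hO.trans_isLittleO ho

theorem integral_indicator_sub_mul {Ω : Type*} [MeasurableSpace Ω] (μ : Measure Ω)
    [IsProbabilityMeasure μ] {A B : Set Ω} (hA : MeasurableSet A) (hB : MeasurableSet B) (q : ℝ) :
    ∫ ω, (A.indicator 1 ω - q) * (B.indicator 1 ω - q) ∂μ =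
      μ.real (A ∩ B) - q * μ.real A - q * μ.real B + q ^ 2 := by
  have hint : ∀ {C : Set Ω}, MeasurableSet C → Integrable (C.indicator (1 : Ω → ℝ)) μ :=
    fun hC => (integrable_const (1 : ℝ)).indicator hC
  have h : ∀ ω, (A.indicator (1 : Ω → ℝ) ω - q) * (B.indicator 1 ω - q) =
      (A ∩ B).indicator 1 ω - q * A.indicator 1 ω - q * B.indicator 1 ω + q ^ 2 := by
    intro ω
    rw [Set.inter_indicator_one, Pi.mul_apply]
    ring
  simp_rw [h]
  have hAB := hint (hA.inter hB)
  have hAA : Integrable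
      (fun ω => (A ∩ B).indicator (1 : Ω → ℝ) ω - q * A.indicator (1 : Ω → ℝ) ω) μ :=
    hAB.sub ((hint hA).const_mul q)
  have hA' := (hint hA).const_mul q
  have hB' := (hint hB).const_mul q
  have hAAB : Integrable (fun ω => (A ∩ B).indicator (1 : Ω → ℝ) ω -
      q * A.indicator (1 : Ω → ℝ) ω - q * B.indicator (1 : Ω → ℝ) ω) μ := hAA.sub hB'
  rw [integral_add hAAB (integrable_const _), integral_sub hAA hB',
    integral_sub hAB hA', integral_const_mul, integral_const_mul, integral_indicator_one hA,
    integral_indicator_one hB, integral_indicator_one (hA.inter hB)]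
  simp

/-- The second moment of the number of vertices of degree `d`, centred at its Poisson value. -/
theorem integral_sq_numDegree_sub_le {α β γ : I} (h1 : (α : ℝ) + β = 1) (h2 : (β : ℝ) + γ = 1)
    (d n : ℕ) :
    ∫ ω, ((numDegree (coinGraph ω) d : ℝ) - 2 ^ n * poissonWeight d 1) ^ 2
        ∂coinMeasure α β γ n ≤ 4 ^ n * ((1 / 2) ^ n + 6 * maxEntry α β γ ^ n) := by
  set q := poissonWeight d 1
  have hq0 : 0 < q := poissonWeight_one_pos d
  have hq1 : q ≤ 1 := poissonWeight_le_one d zero_le_one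
  have hm : 0 ≤ maxEntry α β γ ^ n :=
    pow_nonneg ((probMatrix α β γ 0 0).2.1.trans (probMatrix_le_maxEntry α β γ 0 0)) n
  have hexpand : ∀ ω : Sym2 (Vertex n) → Bool,
      ((numDegree (coinGraph ω) d : ℝ) - 2 ^ n * q) ^ 2 =
        ∑ u, ∑ v, ((degreeEvent u d).indicator 1 ω - q) * ((degreeEvent v d).indicator 1 ω - q) := by
    intro ω
    rw [← Finset.sum_mul_sum, numDegree_coinGraph, sq, Finset.sum_sub_distrib]
    simp
  simp_rw [hexpand]
  rw [integral_finsetSum _ fun u _ => Integrable.of_finite]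
  -- Off the diagonal, `3 * maxEntry ^ n` bounds the covariance and another `3 * maxEntry ^ n` the
  -- product of the two deviations from `q`. The `2 ^ n` diagonal terms give the `(1 / 2) ^ n`.
  have hterm : ∀ u v : Vertex n,
      ∫ ω, ((degreeEvent u d).indicator 1 ω - q) * ((degreeEvent v d).indicator 1 ω - q)
        ∂coinMeasure α β γ n ≤ (if u = v then 1 else 0) + 6 * maxEntry α β γ ^ n := by
    intro u v
    rw [integral_indicator_sub_mul _ MeasurableSet.of_discrete MeasurableSet.of_discrete]
    have hu := abs_degreeEvent_sub_le h1 h2 u d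
    have hv := abs_degreeEvent_sub_le h1 h2 v d
    have hu0 : 0 ≤ (coinMeasure α β γ n).real (degreeEvent u d) := measureReal_nonneg
    have hu1 : (coinMeasure α β γ n).real (degreeEvent u d) ≤ 1 := measureReal_le_one
    have hv0 : 0 ≤ (coinMeasure α β γ n).real (degreeEvent v d) := measureReal_nonneg
    have hv1 : (coinMeasure α β γ n).real (degreeEvent v d) ≤ 1 := measureReal_le_one
    split_ifs with huv
    · subst huv
      rw [Set.inter_self]
      nlinarith
    · have h := degreeEvent_inter_le α β γ huv d
      have hprod : ((coinMeasure α β γ n).real (degreeEvent u d) - q) *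
          ((coinMeasure α β γ n).real (degreeEvent v d) - q) ≤ 3 * maxEntry α β γ ^ n * 1 := by
        refine (le_abs_self _).trans ?_
        rw [abs_mul]
        refine mul_le_mul hu ?_ (abs_nonneg _) (by positivity)
        rw [abs_le]
        constructor <;> linarith
      linarith
  calc _ ≤ ∑ u : Vertex n, ∑ v : Vertex n,
        ((if u = v then (1 : ℝ) else 0) + 6 * maxEntry α β γ ^ n) := by
        refine Finset.sum_le_sum fun u _ => ?_
        rw [integral_finsetSum _ fun v _ => Integrable.of_finite]
        exact Finset.sum_le_sum fun v _ => hterm u v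
    _ = 4 ^ n * ((1 / 2) ^ n + 6 * maxEntry α β γ ^ n) := by
        simp_rw [Finset.sum_add_distrib]
        have h4 : (4 : ℝ) ^ n = 2 ^ n * 2 ^ n := by rw [← mul_pow]; norm_num
        have h12 : (2 : ℝ) ^ n * (1 / 2) ^ n = 1 := by rw [← mul_pow]; norm_num
        simp only [Finset.sum_ite_eq, Finset.mem_univ, if_true, Finset.sum_const,
          Finset.card_univ, Fintype.card_fun, Fintype.card_fin, nsmul_eq_mul, Nat.cast_pow,
          Nat.cast_ofNat, h4]
        linear_combination -(2 : ℝ) ^ n * h12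

/-! ### Asymptotically almost sure events -/

section

variable {α β γ : I} {Q Q' : ∀ n, SimpleGraph (Vertex n) → Prop}

theorem aas_of_tendsto_zero
    (h : Tendsto (fun n => (coinMeasure α β γ n).real {ω | ¬Q n (coinGraph ω)}) atTop (𝓝 0)) :
    AAS α β γ Q := by
  have h' := h.const_sub 1
  rw [sub_zero] at h'
  refine h'.congr fun n => ?_
  rw [kroneckerGraph_real_apply, ← probReal_compl_eq_one_sub MeasurableSet.of_discrete]
  congr 1
  ext ω
  simp

theorem AAS.mono (h : AAS α β γ Q) (hQ : ∀ n G, Q n G → Q' n G) : AAS α β γ Q' :=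
  tendsto_of_tendsto_of_tendsto_of_le_of_le h tendsto_const_nhds
    (fun n => measureReal_mono fun G hG => hQ n G hG) fun _ => measureReal_le_one

/-- Markov's inequality. -/
theorem aas_numDegree_lt {d : ℕ}
    (h : expNumDegree α β γ d =o[atTop] fun n : ℕ => (2 : ℝ) ^ n) {c : ℝ} (hc : 0 < c) :
    AAS α β γ fun n G => (numDegree G d : ℝ) < c * 2 ^ n := by
  refine aas_of_tendsto_zero ?_
  have ht := (isLittleO_iff_tendsto fun n hn => absurd hn (by positivity)).1 h
  have ht' := ht.div_const c
  rw [zero_div] at ht'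
  refine squeeze_zero (fun n => measureReal_nonneg) (fun n => ?_) ht'
  have hM := mul_meas_ge_le_integral_of_nonneg (μ := coinMeasure α β γ n)
    (f := fun ω => (numDegree (coinGraph ω) d : ℝ)) (Eventually.of_forall fun ω => by positivity)
    Integrable.of_finite (c * 2 ^ n)
  have hE : ∫ ω, (numDegree (coinGraph ω) d : ℝ) ∂coinMeasure α β γ n = expNumDegree α β γ d n := by
    rw [expNumDegree, kroneckerGraph, integral_map (measurable_coinGraph n).aemeasurable
      Measurable.of_discrete.aestronglyMeasurable]
  rw [hE] at hM
  simp only [not_lt]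
  rw [div_div, le_div_iff₀ (by positivity)]
  linarith

/-- Chebyshev's inequality, centred at the Poisson value instead of the expectation. -/
theorem aas_abs_numDegree_sub_le (hα₀ : 0 < α) (hα : α < 1) (hβ : β < 1) (hγ : γ < 1)
    (h1 : (α : ℝ) + β = 1) (h2 : (β : ℝ) + γ = 1) (d : ℕ) {ε : ℝ} (hε : 0 < ε) :
    AAS α β γ fun n G => |(numDegree G d : ℝ) - (2 : ℝ) ^ n / (Real.exp 1 * (d.factorial : ℝ))| ≤
      ε * ((2 : ℝ) ^ n / (Real.exp 1 * (d.factorial : ℝ))) := by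
  simp_rw [two_pow_div_eq]
  have hq := poissonWeight_one_pos d
  refine aas_of_tendsto_zero ?_
  have ht : Tendsto (fun n : ℕ => ((1 / 2 : ℝ) ^ n + 6 * maxEntry α β γ ^ n) /
      (ε * poissonWeight d 1) ^ 2) atTop (𝓝 0) := by
    have := ((tendsto_pow_atTop_nhds_zero_of_lt_one (by norm_num : (0 : ℝ) ≤ 1 / 2)
      (by norm_num)).add ((tendsto_maxEntry_pow hα₀ hα hβ hγ).const_mul 6)).div_const
      ((ε * poissonWeight d 1) ^ 2)
    simpa using this
  refine squeeze_zero (fun n => measureReal_nonneg) (fun n => ?_) ht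
  have hM := mul_meas_ge_le_integral_of_nonneg (μ := coinMeasure α β γ n)
    (f := fun ω => ((numDegree (coinGraph ω) d : ℝ) - 2 ^ n * poissonWeight d 1) ^ 2)
    (Eventually.of_forall fun ω => by positivity)
    Integrable.of_finite ((ε * (2 ^ n * poissonWeight d 1)) ^ 2)
  have hM' := hM.trans (integral_sq_numDegree_sub_le h1 h2 d n)
  have hsub : (coinMeasure α β γ n).real {ω | ¬|(numDegree (coinGraph ω) d : ℝ) -
        2 ^ n * poissonWeight d 1| ≤ ε * (2 ^ n * poissonWeight d 1)} ≤
      (coinMeasure α β γ n).real {ω | (ε * (2 ^ n * poissonWeight d 1)) ^ 2 ≤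
        ((numDegree (coinGraph ω) d : ℝ) - 2 ^ n * poissonWeight d 1) ^ 2} := by
    refine measureReal_mono fun ω hω => ?_
    have hω' := not_le.1 (Set.mem_ofPred_eq ▸ hω)
    rw [Set.mem_ofPred_eq, ← sq_abs ((numDegree (coinGraph ω) d : ℝ) - 2 ^ n * poissonWeight d 1)]
    exact pow_le_pow_left₀ (by positivity) hω'.le 2
  refine hsub.trans ?_
  rw [le_div_iff₀ (by positivity)]
  have h4 : (4 : ℝ) ^ n = 2 ^ n * 2 ^ n := by rw [← mul_pow]; norm_num
  refine le_of_mul_le_mul_left (a := (4 : ℝ) ^ n) (le_trans (le_of_eq ?_) hM') (by positivity)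
  rw [h4]
  ring

/-! ### Failure of power laws. -/

theorem exists_div_factorial_lt (T : ℝ) {c : ℝ} (hc : 0 < c) (d₀ : ℕ) :
    ∃ D : ℕ, d₀ ≤ D ∧ 2 / (Real.exp 1 * D.factorial) < c * (D : ℝ) ^ (-T) := by
  have h1 : Tendsto (fun D : ℕ => (D : ℝ) ^ T / Real.exp D) atTop (𝓝 0) :=
    (isLittleO_rpow_exp_atTop T).tendsto_div_nhds_zero.comp tendsto_natCast_atTop_atTop
  have h2 := (h1.mul (FloorSemiring.tendsto_pow_div_factorial_atTop (Real.exp 1))).mul_const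
    (2 / Real.exp 1)
  rw [zero_mul, zero_mul] at h2
  obtain ⟨D, hD, hD0, hD1⟩ := ((h2.eventually_lt_const hc).and
    ((eventually_ge_atTop d₀).and (eventually_ge_atTop 1))).exists
  refine ⟨D, hD0, ?_⟩
  have hDpos : (0 : ℝ) < D := by exact_mod_cast hD1
  have hpow : 0 < (D : ℝ) ^ T := Real.rpow_pos_of_pos hDpos T
  rw [← Real.exp_nat_mul, mul_one] at hD
  rw [Real.rpow_neg hDpos.le, ← div_eq_mul_inv, lt_div_iff₀ hpow]
  refine lt_of_eq_of_lt ?_ hD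
  field_simp

/-- The bounds `c₀ ≤ c` and `τ ≤ T` give one lower bound at degree `D` for all admissible laws at
once. -/
theorem not_isPowerLaw_of_numDegree_lt {n : ℕ} {G : SimpleGraph (Vertex n)} {c₀ T ε : ℝ}
    {d₀ D : ℕ} (hc₀ : 0 < c₀) (hε : ε < 1) (hd₀ : 1 ≤ d₀) (hD : d₀ ≤ D)
    (h : (numDegree G D : ℝ) < (1 - ε) * c₀ * (D : ℝ) ^ (-T) * 2 ^ n) :
    ¬∃ c τ : ℝ, c₀ ≤ c ∧ 0 < τ ∧ τ ≤ T ∧ IsPowerLaw G c τ ε d₀ D := by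
  rintro ⟨c, τ, hc, -, hτ, hG⟩
  have h1 := (abs_le.1 (hG D hD le_rfl)).1
  have hcard : (Nat.card (Vertex n) : ℝ) = 2 ^ n := by simp
  rw [hcard] at h1
  have hD1 : (1 : ℝ) ≤ D := by exact_mod_cast hd₀.trans hD
  have hpow : (D : ℝ) ^ (-T) ≤ (D : ℝ) ^ (-τ) :=
    Real.rpow_le_rpow_of_exponent_le hD1 (by linarith)
  have hle : (1 - ε) * c₀ * (D : ℝ) ^ (-T) * 2 ^ n ≤ (1 - ε) * c * (D : ℝ) ^ (-τ) * 2 ^ n := by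
    have : 0 ≤ 1 - ε := by linarith
    have : 0 ≤ c := hc₀.le.trans hc
    gcongr
  linarith

theorem exists_aas_not_isPowerLaw (hα₀ : 0 < α) (hα : α < 1) (hβ : β < 1) (hγ₀ : 0 < γ)
    (hγ : γ < 1) {c₀ : ℝ} (T : ℝ) {ε : ℝ} {d₀ : ℕ} (hc₀ : 0 < c₀) (hε : ε < 1) (hd₀ : 1 ≤ d₀) :
    ∃ D : ℕ, d₀ ≤ D ∧ AAS α β γ fun _ G =>
      ¬∃ c τ : ℝ, c₀ ≤ c ∧ 0 < τ ∧ τ ≤ T ∧ IsPowerLaw G c τ ε d₀ D := by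
  have hpos : 0 < (1 - ε) * c₀ := mul_pos (by linarith) hc₀
  by_cases h : (α : ℝ) + β = 1 ∧ (β : ℝ) + γ = 1
  · obtain ⟨D, hD, hlt⟩ := exists_div_factorial_lt T hpos d₀
    -- Concentration with relative error 1 suffices: the count is at most twice its Poisson value,
    -- hence the `2` in `hlt`.
    refine ⟨D, hD, (aas_abs_numDegree_sub_le hα₀ hα hβ hγ h.1 h.2 D one_pos).mono
      fun n G hG => not_isPowerLaw_of_numDegree_lt hc₀ hε hd₀ hD ?_⟩
    calc (numDegree G D : ℝ) ≤ 2 / (Real.exp 1 * D.factorial) * 2 ^ n := by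
          have := (abs_le.1 hG).2
          rw [div_mul_eq_mul_div, mul_div_assoc]
          linarith
      _ < _ := by gcongr
  · obtain ⟨k, rfl⟩ := Nat.exists_eq_add_of_le' hd₀
    refine ⟨k + 1, le_rfl, (aas_numDegree_lt (isLittleO_expNumDegree_succ hα₀ hγ₀ h k) ?_).mono
      fun n G hG => not_isPowerLaw_of_numDegree_lt hc₀ hε hd₀ le_rfl hG⟩
    exact mul_pos hpos (Real.rpow_pos_of_pos (by positivity) _)

end

/-! ### Order of growth of the expected counts. -/

theorem isTheta_expNumDegree {α β γ : I} (hα₀ : 0 < α) (hα : α < 1) (hβ : β < 1)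
    (hγ : γ < 1) (h1 : (α : ℝ) + β = 1) (h2 : (β : ℝ) + γ = 1) (d : ℕ) :
    expNumDegree α β γ d =Θ[atTop] fun n : ℕ => (2 : ℝ) ^ n := by
  have h := (isEquivalent_expNumDegree hα₀ hα hβ hγ h1 h2 d).isTheta
  simp_rw [two_pow_div_eq, mul_comm _ (poissonWeight d 1)] at h
  exact h.trans ((isTheta_refl _ _).const_mul_left (poissonWeight_one_pos d).ne')

/-- The first alternative is used only where its base equals 2: for `d = 0`, or when both row sums
are 1. -/
theorem expNumDegree_dichotomy {α β γ : I} (hα₀ : 0 < α) (hα : α < 1) (hβ : β < 1)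
    (hγ₀ : 0 < γ) (hγ : γ < 1) (d : ℕ) :
    (expNumDegree α β γ d =Θ[atTop]
        fun n : ℕ => (((α : ℝ) + (β : ℝ)) ^ d + ((β : ℝ) + (γ : ℝ)) ^ d) ^ n) ∨
      (expNumDegree α β γ d =o[atTop] fun n : ℕ => (2 : ℝ) ^ n) := by
  cases d with
  | zero =>
    rcases le_or_gt (((α : ℝ) + β) * ((β : ℝ) + γ)) 1 with h | h
    · left
      simpa [one_add_one_eq_two] using isTheta_expNumDegree_zero hα₀ hα hβ hγ₀ hγ h
    · exact Or.inr (isLittleO_expNumDegree_of_one_lt hα₀ hγ₀ h 0)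
  | succ d =>
    by_cases h : (α : ℝ) + β = 1 ∧ (β : ℝ) + γ = 1
    · left
      simpa [h.1, h.2, one_add_one_eq_two] using
        isTheta_expNumDegree hα₀ hα hβ hγ h.1 h.2 (d + 1)
    · exact Or.inr (isLittleO_expNumDegree_succ hα₀ hγ₀ h d)

theorem isTheta_expNumDegree_iff {α β γ : I} (hα₀ : 0 < α) (hα : α < 1) (hβ : β < 1)
    (hγ₀ : 0 < γ) (hγ : γ < 1) {d : ℕ} (hd : 1 ≤ d) :
    (expNumDegree α β γ d =Θ[atTop] fun n : ℕ => (2 : ℝ) ^ n) ↔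
      ((α : ℝ) + (β : ℝ) = 1 ∧ (β : ℝ) + (γ : ℝ) = 1) := by
  refine ⟨fun hΘ => ?_, fun h => isTheta_expNumDegree hα₀ hα hβ hγ h.1 h.2 d⟩
  by_contra h
  obtain ⟨k, rfl⟩ := Nat.exists_eq_add_of_le' hd
  have ho := hΘ.symm.trans_isLittleO (isLittleO_expNumDegree_succ hα₀ hγ₀ h k)
  exact isLittleO_irrefl (Eventually.of_forall fun n => by positivity).frequently ho

end Kronecker
theorem theorem1 (α β γ : unitInterval) (hα₀ : 0 < α) (hα₁ : α < 1) (hβ₀ : 0 < β) (hβ₁ : β < 1)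
    (hγ₀ : 0 < γ) (hγ₁ : γ < 1) :
    -- a.a.s. there is no power law in the degrees `d₀, …, D`, for a suitable constant cutoff `D`
    (∀ (c₀ T ε : ℝ) (d₀ : ℕ), 0 < c₀ → 0 < T → 0 < ε → ε < 1 → 1 ≤ d₀ →
      ∃ D : ℕ, d₀ ≤ D ∧
        Kronecker.AAS α β γ fun _ G =>
          ¬ ∃ c τ : ℝ, c₀ ≤ c ∧ 0 < τ ∧ τ ≤ T ∧ Kronecker.IsPowerLaw G c τ ε d₀ D) ∧
    -- the dichotomy for the expected number of vertices of degree `d`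
    (∀ d : ℕ,
      (Kronecker.expNumDegree α β γ d =Θ[atTop]
        fun n : ℕ => (((α : ℝ) + (β : ℝ)) ^ d + ((β : ℝ) + (γ : ℝ)) ^ d) ^ n) ∨
      (Kronecker.expNumDegree α β γ d =o[atTop] fun n : ℕ => (2 : ℝ) ^ n)) ∧
    -- it is linear in the number of vertices in one case only
    (∀ d : ℕ, 1 ≤ d →
      ((Kronecker.expNumDegree α β γ d =Θ[atTop] fun n : ℕ => (2 : ℝ) ^ n) ↔
        ((α : ℝ) + (β : ℝ) = 1 ∧ (β : ℝ) + (γ : ℝ) = 1))) ∧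
    -- in that case the degrees have a Poisson profile with parameter one
    ((α : ℝ) + (β : ℝ) = 1 → (β : ℝ) + (γ : ℝ) = 1 → ∀ d : ℕ,
      (Kronecker.expNumDegree α β γ d ~[atTop]
        fun n : ℕ => (2 : ℝ) ^ n / (Real.exp 1 * (d.factorial : ℝ))) ∧
      ∀ ε : ℝ, 0 < ε → Kronecker.AAS α β γ fun n G =>
        |(Kronecker.numDegree G d : ℝ) - (2 : ℝ) ^ n / (Real.exp 1 * (d.factorial : ℝ))| ≤
          ε * ((2 : ℝ) ^ n / (Real.exp 1 * (d.factorial : ℝ)))) := by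
  exact ⟨fun _ T _ _ hc₀ _ _ hε₁ hd₀ =>
      Kronecker.exists_aas_not_isPowerLaw hα₀ hα₁ hβ₁ hγ₀ hγ₁ T hc₀ hε₁ hd₀,
    Kronecker.expNumDegree_dichotomy hα₀ hα₁ hβ₁ hγ₀ hγ₁,
    fun _ => Kronecker.isTheta_expNumDegree_iff hα₀ hα₁ hβ₁ hγ₀ hγ₁,
    fun h1 h2 d => ⟨Kronecker.isEquivalent_expNumDegree hα₀ hα₁ hβ₁ hγ₁ h1 h2 d,
      fun _ => Kronecker.aas_abs_numDegree_sub_le hα₀ hα₁ hβ₁ hγ₁ h1 h2 d⟩⟩
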